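/- **Setting.** Let $f:\mathbb R^n\to\mathbb R$ be twice continuously differentiable and bounded below, $g=\nabla f$, $H=\nabla^2 f$; $\|\cdot\|$ is the Euclidean norm of a vector or the induced 2-norm of a matrix. Fix parameters $\xi_1,\xi_3>0$, $\xi_2,\eta,\gamma_C\in(0,1)$, $0<\underline\sigma<\overline\sigma$, $\gamma_E,\gamma_\lambda>1$, and tolerances $\tau_{k,j}\ge 0$. The inexact trust-region algorithm I-TRACE starts from $x_0\in\mathbb R^n$, $\delta_0>0$, $\sigma_0\in[\underline\sigma,\overline\sigma]$. Write $f_k=f(x_k)$, $g_k=g(x_k)$, $H_k=H(x_k)$. *Lanczos process.* $y_{k,0}=g_k$, $q_{k,-1}=0$, $\gamma_{k,j}=\|y_{k,j}\|$, $q_{k,j}=y_{k,j}/\gamma_{k,j}$, $\theta_{k,j}=q_{k,j}^TH_kq_{k,j}$, $y_{k,j+1}=H_kq_{k,j}-\theta_{k,j}q_{k,j}-\gamma_{k,j}q_{k,j-1}$; $Q_{k,j}=[q_{k,0}\ \cdots\ q_{k,j}]$, and $T_{k,j}$ is the symmetric tridiagonal matrix with diagonal $\theta_{k,0},\dots,\theta_{k,j}$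 and off-diagonal $\gamma_{k,1},\dots,\gamma_{k,j}$. To solve $\mathcal S_{k,j}(\delta)$ means to find a primal-dual globally optimal pair $(t,\lambda)$ of $\min_{\|t\|\le\delta}\gamma_{k,0}e_1^Tt+\frac12t^TT_{k,j}t$, i.e. $\gamma_{k,0}e_1+(T_{k,j}+\lambda I)t=0$, $T_{k,j}+\lambda I\succeq0$, $\lambda\ge0$, $\|t\|\le\delta$, $\lambda(\delta-\|t\|)=0$. To solve $\mathcal R_{k,j}(\lambda)$, where $T_{k,j}+\lambda I\succ0$, means to find $t$ with $(T_{k,j}+\lambda I)t=-\gamma_{k,0}e_1$. The residual of $t\in\mathbb R^{j+1}$ is $\mu_{k,j}=\gamma_{k,j+1}|e_{j+1}^Tt|$. The *termination test* for $(t,\lambda)$ is: either $\mu_{k,j}\le\xi_1\|t\|^2$, or both $\mu_{k,j}\le\xi_2\min\{1,\|t\|\}\gamma_{k,0}$ and $1\le\xi_3\min\{1,\|t\|\}\|T_{k,j}+\lambda I\|$. Let $\rho_k(s)=(f_k-f(x_k+s))/\|s\|^3$. *Find decrease step (FDS)* for $(k,j)$ starts with $l=0$, a solution $(t_0,\lambda_0)$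 of $\mathcal S_{k,j}(\delta_k)$, and the values $\delta_k,\sigma_k$ in place of $\delta_0,\sigma_0$; index $l$ has data $(t_l,\lambda_l,\delta_l,\sigma_l)$. (i) If $\rho_k(Q_{k,j}t_l)\ge\eta$ and $\lambda_l/\|t_l\|\le\sigma_l$, return this data. (ii) If $\rho_k(Q_{k,j}t_l)\ge\eta$ and $\lambda_l/\|t_l\|>\sigma_l$, set $\delta_{l+1}=\lambda_l/\sigma_l$, let $(t_{l+1},\lambda_{l+1})$ solve $\mathcal S_{k,j}(\delta_{l+1})$, and set $\sigma_{l+1}=\sigma_l$. (iii) If $\rho_k(Q_{k,j}t_l)<\eta$ and $\lambda_l<\underline\sigma\|t_l\|$, let $\hat\lambda=\lambda_l+(\underline\sigma\gamma_{k,0})^{1/2}$ and let $\hat t$ solve $\mathcal R_{k,j}(\hat\lambda)$. If $\hat\lambda/\|\hat t\|\le\overline\sigma$, set $(t_{l+1},\lambda_{l+1})=(\hat t,\hat\lambda)$; otherwise choose $\lambda_{l+1}\in(\lambda_l,\hat\lambda)$ such that the solution $t_{l+1}$ of $\mathcal R_{k,j}(\lambda_{l+1})$ has $\underline\sigma<\lambda_{l+1}/\|t_{l+1}\|<\overline\sigma$.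 In both cases $\delta_{l+1}=\|t_{l+1}\|$. (iv) If $\rho_k(Q_{k,j}t_l)<\eta$ and $\lambda_l\ge\underline\sigma\|t_l\|$, let $\hat t$ solve $\mathcal R_{k,j}(\gamma_\lambda\lambda_l)$. If $\|\hat t\|\ge\gamma_C\delta_l$, set $(t_{l+1},\lambda_{l+1},\delta_{l+1})=(\hat t,\gamma_\lambda\lambda_l,\|\hat t\|)$; otherwise set $\delta_{l+1}=\gamma_C\delta_l$ and let $(t_{l+1},\lambda_{l+1})$ solve $\mathcal S_{k,j}(\delta_{l+1})$. In (iii) and (iv), $\sigma_{l+1}=\max\{\sigma_l,\lambda_{l+1}/\|t_{l+1}\|\}$. *Iteration $k$.* For $j=0,1,\dots$ solve $\mathcal S_{k,j}(\delta_k)$ until its solution passes the termination test. From this $j$ on, call FDS for $(k,j)$. If its output $(t,\lambda,\bar\delta,\bar\sigma)$ passes the termination test **and, in addition, $\mu_{k,j}\le\tau_{k,j}$**, set $s_k=Q_{k,j}t$ and leave the loop; otherwise increase $j$ by one, solve $\mathcal S_{k,j}(\delta_k)$ and call FDS again. Then $x_{k+1}=x_k+s_k$, $\delta_{k+1}=\max\{\bar\delta,\gamma_E\|s_k\|\}$,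 $\sigma_{k+1}=\bar\sigma$. **Theorem.** Let $\{x_k\}_{k\in\mathbb N}$ be the iterates of an (infinite) execution of this algorithm. Suppose that $g_k\ne0$ for all $k$, and that $g$ and $H$ are Lipschitz continuous on some open convex set containing every iterate $x_k$ and every trial point $x_k+Q_{k,j}t_l$ arising in the calls of FDS. Suppose that some subsequence of $\{x_k\}$ converges to a point $x_*$ with $H(x_*)\succ0$, and that $H$ is Lipschitz continuous on a neighborhood of $x_*$. 1. If the additional requirement is $\mu_{k,j}=o(\|g_k\|)$, i.e. there is a sequence $\varepsilon_k\to0$ with $\tau_{k,j}\le\varepsilon_k\|g_k\|$ for all $k,j$, then $x_k\to x_*$ Q-superlinearly: $x_k\to x_*$ and $\|x_{k+1}-x_*\|=o(\|x_k-x_*\|)$. 2. If the additional requirement is $\mu_{k,j}=O(\|g_k\|^2)$, i.e. there is a constant $c$ with $\tau_{k,j}\le c\|g_k\|^2$ for all $k,j$, then $x_k\to x_*$ Q-quadratically: $x_k\to x_*$ and $\|x_{k+1}-x_*\|=O(\|x_k-x_*\|^2)$. -/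

import Mathlib

open Filter Topology

noncomputable section

namespace ITrace

/-- The space `ℝⁿ` with the Euclidean norm. -/
abbrev Vec (n : ℕ) : Type := EuclideanSpace ℝ (Fin n)

/-- The Hessian of `f` at `x`, as the linear operator obtained by differentiating the gradient;
its norm is the induced 2-norm. -/
def hess {n : ℕ} (f : Vec n → ℝ) (x : Vec n) : Vec n →L[ℝ] Vec n :=
  fderiv ℝ (gradient f) x

/-! ### The Lanczos process and the reduced subproblems -/

/-- The state `(q_{j-1}, y_j)` of the Lanczos process for the operator `H` started at `g`:
`q_{-1} = 0`, `y_0 = g`, `q_j = y_j / ‖y_j‖` and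
`y_{j+1} = H q_j - (q_jᵀ H q_j) q_j - ‖y_j‖ q_{j-1}`. -/
def lanczos {n : ℕ} (H : Vec n →L[ℝ] Vec n) (g : Vec n) : ℕ → Vec n × Vec n
  | 0 => (0, g)
  | j + 1 =>
    let p := lanczos H g j
    let q := ‖p.2‖⁻¹ • p.2
    (q, H q - (inner ℝ q (H q)) • q - ‖p.2‖ • p.1)

/-- `γ_j = ‖y_j‖`; in particular `γ_0 = ‖g‖`. -/
def lanczosGamma {n : ℕ} (H : Vec n →L[ℝ] Vec n) (g : Vec n) (j : ℕ) : ℝ :=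
  ‖(lanczos H g j).2‖

/-- The Lanczos vector `q_j = y_j / γ_j`. -/
def lanczosQ {n : ℕ} (H : Vec n →L[ℝ] Vec n) (g : Vec n) (j : ℕ) : Vec n :=
  (lanczos H g (j + 1)).1

/-- `θ_j = q_jᵀ H q_j`. -/
def lanczosTheta {n : ℕ} (H : Vec n →L[ℝ] Vec n) (g : Vec n) (j : ℕ) : ℝ :=
  inner ℝ (lanczosQ H g j) (H (lanczosQ H g j))

/-- The tridiagonal matrix `T_j`, of order `j + 1`, with diagonal `θ_0, …, θ_j` and
off-diagonal entries `γ_1, …, γ_j`. -/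
def lanczosT {n : ℕ} (H : Vec n →L[ℝ] Vec n) (g : Vec n) (j : ℕ) :
    Matrix (Fin (j + 1)) (Fin (j + 1)) ℝ :=
  Matrix.of fun a b =>
    if a = b then lanczosTheta H g a
    else if (a : ℕ) + 1 = b then lanczosGamma H g b
    else if (b : ℕ) + 1 = a then lanczosGamma H g a
    else 0

/-- The matrix `T_j + lam I`. -/
def shiftT {n : ℕ} (H : Vec n →L[ℝ] Vec n) (g : Vec n) (j : ℕ) (lam : ℝ) :
    Matrix (Fin (j + 1)) (Fin (j + 1)) ℝ :=
  lanczosT H g j + lam • (1 : Matrix (Fin (j + 1)) (Fin (j + 1)) ℝ)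

/-- The full-space step `Q_j t`, where `Q_j` has the columns `q_0, …, q_j`. -/
def applyQ {n : ℕ} (H : Vec n →L[ℝ] Vec n) (g : Vec n) {j : ℕ} (t : Vec (j + 1)) : Vec n :=
  ∑ i : Fin (j + 1), t i • lanczosQ H g i

/-- The residual norm `μ_j = γ_{j+1} |e_{j+1}ᵀ t|` of a reduced step `t`. -/
def resid {n : ℕ} (H : Vec n →L[ℝ] Vec n) (g : Vec n) {j : ℕ} (t : Vec (j + 1)) : ℝ :=
  lanczosGamma H g (j + 1) * |t (Fin.last j)|

/-- `(t, lam)` is a primal-dual globally optimal solution of the reduced trust-region subproblem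
`min γ_0 e_1ᵀ t + ½ tᵀ T_j t` subject to `‖t‖ ≤ δ`, i.e. it satisfies the (necessary and
sufficient) conditions for global optimality. -/
def SolvesTR {n : ℕ} (H : Vec n →L[ℝ] Vec n) (g : Vec n) {j : ℕ} (δ : ℝ)
    (t : Vec (j + 1)) (lam : ℝ) : Prop :=
  lanczosGamma H g 0 • EuclideanSpace.single (0 : Fin (j + 1)) (1 : ℝ)
      + Matrix.toEuclideanCLM (𝕜 := ℝ) (shiftT H g j lam) t = 0 ∧
    (shiftT H g j lam).PosSemidef ∧
    0 ≤ lam ∧ ‖t‖ ≤ δ ∧ lam * (δ - ‖t‖) = 0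

/-- `t` solves the reduced regularized subproblem `min γ_0 e_1ᵀ t + ½ tᵀ (T_j + lam I) t`, where
`T_j + lam I` is positive definite, i.e. `(T_j + lam I) t = - γ_0 e_1`. -/
def SolvesReg {n : ℕ} (H : Vec n →L[ℝ] Vec n) (g : Vec n) {j : ℕ} (lam : ℝ)
    (t : Vec (j + 1)) : Prop :=
  (shiftT H g j lam).PosDef ∧
    Matrix.toEuclideanCLM (𝕜 := ℝ) (shiftT H g j lam) t
      = -(lanczosGamma H g 0 • EuclideanSpace.single (0 : Fin (j + 1)) (1 : ℝ))

/-! ### Parameters and the algorithm -/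

/-- The user-prescribed parameters of the algorithm. -/
structure Params where
  ξ₁ : ℝ
  ξ₂ : ℝ
  ξ₃ : ℝ
  η : ℝ
  σlo : ℝ
  σhi : ℝ
  γC : ℝ
  γE : ℝ
  γL : ℝ
  ξ₁_pos : 0 < ξ₁
  ξ₂_pos : 0 < ξ₂
  ξ₂_lt : ξ₂ < 1
  ξ₃_pos : 0 < ξ₃
  η_pos : 0 < η
  η_lt : η < 1
  σlo_pos : 0 < σlo
  σlo_lt : σlo < σhi
  γC_pos : 0 < γC
  γC_lt : γC < 1
  γE_gt : 1 < γE
  γL_gt : 1 < γL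

/-- The termination test in the reduced space: either `μ ≤ ξ₁ ‖t‖²`, or both
`μ ≤ ξ₂ min{1, ‖t‖} γ_0` and `1 ≤ ξ₃ min{1, ‖t‖} ‖T_j + lam I‖`. -/
def TermTest {n : ℕ} (P : Params) (H : Vec n →L[ℝ] Vec n) (g : Vec n) {j : ℕ}
    (t : Vec (j + 1)) (lam : ℝ) : Prop :=
  resid H g t ≤ P.ξ₁ * ‖t‖ ^ 2 ∨
    (resid H g t ≤ P.ξ₂ * min 1 ‖t‖ * lanczosGamma H g 0 ∧
      1 ≤ P.ξ₃ * min 1 ‖t‖ * ‖Matrix.toEuclideanCLM (𝕜 := ℝ) (shiftT H g j lam)‖)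

/-- The ratio `ρ(s) = (f(x) - f(x + s)) / ‖s‖³`. -/
def decRatio {n : ℕ} (f : Vec n → ℝ) (x s : Vec n) : ℝ :=
  (f x - f (x + s)) / ‖s‖ ^ 3

/-- The quantities `(t, lam, δ, σ)` held by the subroutine "find decrease step" for a fixed
Krylov dimension. -/
structure FDSState (j : ℕ) where
  t : Vec (j + 1)
  lam : ℝ
  δ : ℝ
  σ : ℝ

/-- The full-space trial step `Q_j t` of a state, at the point `x`. -/
def FDSState.step {n j : ℕ} (f : Vec n → ℝ) (x : Vec n) (a : FDSState j) : Vec n :=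
  applyQ (hess f x) (gradient f x) a.t

/-- The subroutine "find decrease step" returns the state `a`. -/
def FDSDone {n j : ℕ} (P : Params) (f : Vec n → ℝ) (x : Vec n) (a : FDSState j) : Prop :=
  P.η ≤ decRatio f x (a.step f x) ∧ a.lam / ‖a.t‖ ≤ a.σ

/-- One pass of the loop of "find decrease step" that does not return: `a` is replaced by `b`.
The constructors are the expansion of the trust region and the four kinds of contraction. -/
inductive FDSStep {n j : ℕ} (P : Params) (f : Vec n → ℝ) (x : Vec n) :
    FDSState j → FDSState j → Prop
  | expand (a b : FDSState j)
      (hρ : P.η ≤ decRatio f x (a.step f x))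
      (hσ : a.σ < a.lam / ‖a.t‖)
      (hδ' : b.δ = a.lam / a.σ)
      (hsolve : SolvesTR (hess f x) (gradient f x) b.δ b.t b.lam)
      (hσ' : b.σ = a.σ) : FDSStep P f x a b
  | contractSmall (a b : FDSState j)
      (hρ : decRatio f x (a.step f x) < P.η)
      (hsmall : a.lam < P.σlo * ‖a.t‖)
      (hlam' : b.lam = a.lam + Real.sqrt (P.σlo * lanczosGamma (hess f x) (gradient f x) 0))
      (hsolve : SolvesReg (hess f x) (gradient f x) b.lam b.t)
      (htest : b.lam / ‖b.t‖ ≤ P.σhi)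
      (hδ' : b.δ = ‖b.t‖)
      (hσ' : b.σ = max a.σ (b.lam / ‖b.t‖)) : FDSStep P f x a b
  | contractBetween (a b : FDSState j) (lamHat : ℝ) (tHat : Vec (j + 1))
      (hρ : decRatio f x (a.step f x) < P.η)
      (hsmall : a.lam < P.σlo * ‖a.t‖)
      (hlamHat : lamHat = a.lam + Real.sqrt (P.σlo * lanczosGamma (hess f x) (gradient f x) 0))
      (hsolveHat : SolvesReg (hess f x) (gradient f x) lamHat tHat)
      (htest : P.σhi < lamHat / ‖tHat‖)
      (hlam_lo : a.lam < b.lam) (hlam_hi : b.lam < lamHat)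
      (hsolve : SolvesReg (hess f x) (gradient f x) b.lam b.t)
      (hratio_lo : P.σlo < b.lam / ‖b.t‖) (hratio_hi : b.lam / ‖b.t‖ < P.σhi)
      (hδ' : b.δ = ‖b.t‖)
      (hσ' : b.σ = max a.σ (b.lam / ‖b.t‖)) : FDSStep P f x a b
  | contractLarge (a b : FDSState j)
      (hρ : decRatio f x (a.step f x) < P.η)
      (hlarge : P.σlo * ‖a.t‖ ≤ a.lam)
      (hlam' : b.lam = P.γL * a.lam)
      (hsolve : SolvesReg (hess f x) (gradient f x) b.lam b.t)
      (htest : P.γC * a.δ ≤ ‖b.t‖)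
      (hδ' : b.δ = ‖b.t‖)
      (hσ' : b.σ = max a.σ (b.lam / ‖b.t‖)) : FDSStep P f x a b
  | contractRadius (a b : FDSState j) (tHat : Vec (j + 1))
      (hρ : decRatio f x (a.step f x) < P.η)
      (hlarge : P.σlo * ‖a.t‖ ≤ a.lam)
      (hsolveHat : SolvesReg (hess f x) (gradient f x) (P.γL * a.lam) tHat)
      (htest : ‖tHat‖ < P.γC * a.δ)
      (hδ' : b.δ = P.γC * a.δ)
      (hsolve : SolvesTR (hess f x) (gradient f x) b.δ b.t b.lam)
      (hσ' : b.σ = max a.σ (b.lam / ‖b.t‖)) : FDSStep P f x a b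

/-- A record of all quantities computed in an execution of the algorithm. Entries are meaningful
for the generated indices only. -/
structure Trace (n : ℕ) where
  /-- the iterates `x_k` -/
  x : ℕ → Vec n
  /-- the initial trust-region radius `δ_k` of iteration `k` -/
  δ : ℕ → ℝ
  /-- the initial ratio bound `σ_k` of iteration `k` -/
  σ : ℕ → ℝ
  /-- the index `j` returned by the truncated Lanczos subroutine in iteration `k` -/
  jFirst : ℕ → ℕ
  /-- the index `j` at which the step of iteration `k` is accepted -/
  jLast : ℕ → ℕ
  /-- the primal solution computed for the subproblem of index `j` with radius `δ_k` -/
  tSub : ℕ → (j : ℕ) → Vec (j + 1)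
  /-- the dual solution computed for the subproblem of index `j` with radius `δ_k` -/
  lamSub : ℕ → ℕ → ℝ
  /-- the index `l` at which the call of "find decrease step" for `(k, j)` returns -/
  lLast : ℕ → ℕ → ℕ
  /-- the quantities `(t, lam, δ, σ)` of index `(k, j, l)` in "find decrease step" -/
  fds : ℕ → (j : ℕ) → ℕ → FDSState j

namespace Trace

variable {n : ℕ} (R : Trace n)

/-- The state returned by "find decrease step" for the pair `(k, j)`. -/
def out (k j : ℕ) : FDSState j := R.fds k j (R.lLast k j)

/-- "Find decrease step" is called for `(k, j)`, and its loop reaches the index `l`. -/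
def Generated (k j l : ℕ) : Prop :=
  R.jFirst k ≤ j ∧ j ≤ R.jLast k ∧ l ≤ R.lLast k j

/-- The step `s_k = Q_{k,j} t_{k,j}` that is accepted in iteration `k`. -/
def acceptedStep (f : Vec n → ℝ) (k : ℕ) : Vec n :=
  (R.out k (R.jLast k)).step f (R.x k)

/-- The acceptance test of the algorithm for the output of "find decrease step" for `(k, j)`:
the termination test, together with the additional requirement `μ_{k,j} ≤ τ_{k,j}`. -/
def AcceptTest (P : Params) (f : Vec n → ℝ) (τ : ℕ → ℕ → ℝ) (k j : ℕ) : Prop :=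
  TermTest P (hess f (R.x k)) (gradient f (R.x k)) (R.out k j).t (R.out k j).lam ∧
    resid (hess f (R.x k)) (gradient f (R.x k)) (R.out k j).t ≤ τ k j

/-- `R` records an infinite execution of the algorithm on `f` with the parameters `P`, where the
acceptance test has the additional requirement `μ_{k,j} ≤ τ_{k,j}`. -/
structure IsRun (P : Params) (f : Vec n → ℝ) (τ : ℕ → ℕ → ℝ) : Prop where
  δ_zero : 0 < R.δ 0
  σ_zero : P.σlo ≤ R.σ 0 ∧ R.σ 0 ≤ P.σhi
  /-- the acceptance loop starts at the index returned by the truncated Lanczos subroutine -/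
  first_le_last : ∀ k, R.jFirst k ≤ R.jLast k
  /-- the trust-region subproblems with radius `δ_k` -/
  sub_solves : ∀ k j, j ≤ R.jLast k →
    SolvesTR (hess f (R.x k)) (gradient f (R.x k)) (R.δ k) (R.tSub k j) (R.lamSub k j)
  /-- the truncated Lanczos subroutine stops at the first index that passes its test -/
  tltr_continue : ∀ k j, j < R.jFirst k →
    ¬ TermTest P (hess f (R.x k)) (gradient f (R.x k)) (R.tSub k j) (R.lamSub k j)
  tltr_stop : ∀ k,
    TermTest P (hess f (R.x k)) (gradient f (R.x k)) (R.tSub k (R.jFirst k))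
      (R.lamSub k (R.jFirst k))
  /-- each call of "find decrease step" starts from the subproblem solution, `δ_k` and `σ_k` -/
  fds_start : ∀ k j, R.jFirst k ≤ j → j ≤ R.jLast k →
    R.fds k j 0 = ⟨R.tSub k j, R.lamSub k j, R.δ k, R.σ k⟩
  fds_step : ∀ k j l, R.jFirst k ≤ j → j ≤ R.jLast k → l < R.lLast k j →
    FDSStep P f (R.x k) (R.fds k j l) (R.fds k j (l + 1))
  fds_done : ∀ k j, R.jFirst k ≤ j → j ≤ R.jLast k → FDSDone P f (R.x k) (R.out k j)
  /-- the Krylov dimension grows until the acceptance test is passed -/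
  reject : ∀ k j, R.jFirst k ≤ j → j < R.jLast k → ¬ R.AcceptTest P f τ k j
  accept : ∀ k, R.AcceptTest P f τ k (R.jLast k)
  x_succ : ∀ k, R.x (k + 1) = R.x k + R.acceptedStep f k
  δ_succ : ∀ k, R.δ (k + 1) = max (R.out k (R.jLast k)).δ (P.γE * ‖R.acceptedStep f k‖)
  σ_succ : ∀ k, R.σ (k + 1) = (R.out k (R.jLast k)).σ

/-- The standing assumption on the objective: `f` is twice continuously differentiable and bounded
below, and its gradient and Hessian are Lipschitz continuous on an open convex set that contains
all iterates and all generated trial points. -/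
def StandingAssumption (f : Vec n → ℝ) : Prop :=
  ContDiff ℝ 2 f ∧ BddBelow (Set.range f) ∧
    ∃ U : Set (Vec n), IsOpen U ∧ Convex ℝ U ∧
      (∀ k, R.x k ∈ U) ∧
      (∀ k j l, R.Generated k j l → R.x k + (R.fds k j l).step f (R.x k) ∈ U) ∧
      (∃ gLip : NNReal, LipschitzOnWith gLip (gradient f) U) ∧
      (∃ HLip : NNReal, LipschitzOnWith HLip (hess f) U)

end Trace

/-- `x_k → xs` Q-superlinearly: `x_k → xs` and `‖x_{k+1} - xs‖ = o(‖x_k - xs‖)`. -/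
def QSuperlinear {n : ℕ} (x : ℕ → Vec n) (xs : Vec n) : Prop :=
  Tendsto x atTop (𝓝 xs) ∧
    Asymptotics.IsLittleO atTop (fun k => ‖x (k + 1) - xs‖) (fun k => ‖x k - xs‖)

/-- `x_k → xs` Q-quadratically: `x_k → xs` and `‖x_{k+1} - xs‖ = O(‖x_k - xs‖²)`. -/
def QQuadratic {n : ℕ} (x : ℕ → Vec n) (xs : Vec n) : Prop :=
  Tendsto x atTop (𝓝 xs) ∧
    Asymptotics.IsBigO atTop (fun k => ‖x (k + 1) - xs‖) (fun k => ‖x k - xs‖ ^ 2)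

end ITrace

end

/-! Let `s` be the accepted step, `lam` its multiplier and `μ` its residual. The Lanczos relation
turns the reduced optimality conditions into `H s + lam • s + g = r`, with `r` orthogonal to `s` and
`‖r‖ = μ`. Hence the next gradient is a Taylor remainder plus `r` minus `lam • s`. Acceptance gives
`lam ≤ σ ‖s‖`, so if `σ` is bounded along the run, `‖g_{k+1}‖ ≤ C ‖s_k‖ ^ 2 + μ_k`
(`IsRun.accepted_step_bounds`).

The bound on `σ` holds because `σ` can grow only after a rejected trial step, and Taylor expansion
forces `lam ≤ (2η + 2L) ‖t‖` for such a step (`lam_le_of_decRatio_lt`); a contraction then worsens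
this ratio by a bounded factor.

Sufficient decrease and boundedness below give `s_k → 0`. The termination test makes the gradient
bound a contracting recursion, so `g_k → 0`. Near `xs` the gradient norm is comparable to the
distance, so the cluster point is isolated among stationary points and vanishing steps cannot leave
it: the whole sequence converges.

Near `xs` the Hessian is uniformly positive definite, so `‖s_k‖ = O(‖g_k‖) = O(‖x_k - xs‖)`, and
therefore `‖x_{k+1} - xs‖ ≤ A ‖x_k - xs‖ ^ 2 + B τ` (`IsRun.local_recursion`). Both rates are read
off from this. -/

namespace ITrace

variable {n : ℕ}

/-! ### The Lanczos process: orthonormality and the relation between `H` and `T_j` -/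

section Lanczos

variable (H : Vec n →L[ℝ] Vec n) (g : Vec n)

theorem gamma_smul_q (j : ℕ) :
    lanczosGamma H g j • lanczosQ H g j = (lanczos H g j).2 := by
  change ‖(lanczos H g j).2‖ • (‖(lanczos H g j).2‖⁻¹ • (lanczos H g j).2) = _
  by_cases h : (lanczos H g j).2 = 0
  · simp [h]
  · rw [smul_smul, mul_inv_cancel₀ (norm_ne_zero_iff.2 h), one_smul]

theorem lanczos_three_term (j : ℕ) :
    H (lanczosQ H g j) = (lanczos H g (j + 1)).2 + lanczosTheta H g j • lanczosQ H g j
      + lanczosGamma H g j • (lanczos H g j).1 := by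
  have : (lanczos H g (j + 1)).2 = H (lanczosQ H g j) - lanczosTheta H g j • lanczosQ H g j
      - lanczosGamma H g j • (lanczos H g j).1 := rfl
  rw [this]; abel

/-- The Lanczos vectors `q_0, …, q_j` are orthonormal. -/
def LanczosOrtho (j : ℕ) : Prop :=
  ∀ a b, a ≤ j → b ≤ j →
    inner ℝ (lanczosQ H g a) (lanczosQ H g b) = if a = b then (1 : ℝ) else 0

variable {H g}

/-- For `a = j` the `θ` term cancels. For `a < j`, symmetry moves `H` onto `q_a`; by the three-term
recurrence `H q_a` meets `q_j` only through `γ_{a+1} q_{a+1}`, nonzero only if `a + 1 = j`, and that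
is what subtracting `γ_j q_{j-1}` removes. -/
theorem LanczosOrtho.inner_next (hH : ∀ u v, inner ℝ (H u) v = inner ℝ u (H v)) {j : ℕ}
    (ho : LanczosOrtho H g j) {a : ℕ} (ha : a ≤ j) :
    inner ℝ (lanczosQ H g a) (lanczos H g (j + 1)).2 = (0 : ℝ) := by
  have hprev : ∀ b ≤ j, ∀ c ≤ b, inner ℝ (lanczos H g c).1 (lanczosQ H g b) = (0 : ℝ) := by
    intro b hb c hc
    cases c with
    | zero => exact inner_zero_left _
    | succ c =>
      have := ho c b (by omega) hb
      rw [if_neg (by omega)] at this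
      exact this
  have h3 : (lanczos H g (j + 1)).2 = H (lanczosQ H g j) - lanczosTheta H g j • lanczosQ H g j
      - lanczosGamma H g j • (lanczos H g j).1 := rfl
  rw [h3, inner_sub_right, inner_sub_right, inner_smul_right, inner_smul_right]
  rcases ha.eq_or_lt with rfl | hlt
  · rw [ho a a le_rfl le_rfl, if_pos rfl, real_inner_comm (lanczos H g a).1,
      hprev a le_rfl a le_rfl]
    change lanczosTheta H g a - _ - _ = _
    ring
  · obtain ⟨b, rfl⟩ : ∃ b, j = b + 1 := ⟨j - 1, by omega⟩
    rw [← hH, lanczos_three_term, ← gamma_smul_q, inner_add_left, inner_add_left,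
      inner_smul_left, inner_smul_left, inner_smul_left, ho _ _ (by omega) le_rfl,
      ho _ _ ha le_rfl, hprev _ le_rfl _ ha]
    change _ - lanczosGamma H g (b + 1) * inner ℝ (lanczosQ H g a) (lanczosQ H g b) = _
    rw [ho a b (by omega) (by omega), if_neg (show a ≠ b + 1 by omega)]
    by_cases h : a = b
    · subst h; simp
    · simp [h]

theorem lanczosOrtho (hH : ∀ u v, inner ℝ (H u) v = inner ℝ u (H v)) (j : ℕ)
    (hγ : ∀ i ≤ j, lanczosGamma H g i ≠ 0) : LanczosOrtho H g j := by
  have hself : ∀ i ≤ j, inner ℝ (lanczosQ H g i) (lanczosQ H g i) = (1 : ℝ) := by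
    intro i hi
    rw [real_inner_self_eq_norm_sq]
    have : ‖lanczosQ H g i‖ = 1 := by
      change ‖‖(lanczos H g i).2‖⁻¹ • (lanczos H g i).2‖ = 1
      rw [norm_smul, norm_inv, norm_norm]
      exact inv_mul_cancel₀ (hγ i hi)
    rw [this, one_pow]
  induction j with
  | zero =>
    intro a b ha hb
    obtain rfl : a = 0 := by omega
    obtain rfl : b = 0 := by omega
    simpa using hself 0 le_rfl
  | succ j ih =>
    have ho := ih (fun i hi => hγ i (by omega)) (fun i hi => hself i (by omega))
    have hnext : ∀ a ≤ j, inner ℝ (lanczosQ H g a) (lanczosQ H g (j + 1)) = (0 : ℝ) := by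
      intro a ha
      change inner ℝ (lanczosQ H g a)
        (‖(lanczos H g (j + 1)).2‖⁻¹ • (lanczos H g (j + 1)).2) = (0 : ℝ)
      rw [inner_smul_right, ho.inner_next hH ha, mul_zero]
    intro a b ha hb
    rcases ha.eq_or_lt with rfl | ha
    · rcases hb.eq_or_lt with rfl | hb
      · simpa using hself _ le_rfl
      · rw [real_inner_comm, hnext b (by omega), if_neg (by omega)]
    · rcases hb.eq_or_lt with rfl | hb
      · rw [hnext a (by omega), if_neg (by omega)]
      · exact ho a b (by omega) (by omega)

theorem LanczosOrtho.inner_applyQ {j : ℕ} (ho : LanczosOrtho H g j) (t u : Vec (j + 1)) :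
    inner ℝ (applyQ H g t) (applyQ H g u) = (inner ℝ t u : ℝ) := by
  simp only [applyQ, sum_inner, inner_sum, inner_smul_left, inner_smul_right]
  rw [PiLp.inner_apply]
  refine Finset.sum_congr rfl fun a _ => ?_
  rw [Finset.sum_eq_single a]
  · rw [ho a a (by omega) (by omega), if_pos rfl]
    simp [mul_comm]
  · intro b _ hb
    rw [ho b a (by omega) (by omega), if_neg (fun h => hb (Fin.ext h))]
    simp
  · simp

theorem LanczosOrtho.norm_applyQ {j : ℕ} (ho : LanczosOrtho H g j) (t : Vec (j + 1)) :
    ‖applyQ H g t‖ = ‖t‖ := by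
  rw [norm_eq_sqrt_real_inner, norm_eq_sqrt_real_inner, ho.inner_applyQ]

theorem LanczosOrtho.inner_applyQ_next (hH : ∀ u v, inner ℝ (H u) v = inner ℝ u (H v)) {j : ℕ}
    (ho : LanczosOrtho H g j) (t : Vec (j + 1)) :
    inner ℝ (applyQ H g t) (lanczos H g (j + 1)).2 = (0 : ℝ) := by
  simp only [applyQ, sum_inner, inner_smul_left]
  exact Finset.sum_eq_zero fun a _ => by rw [ho.inner_next hH (by omega), mul_zero]

/-- Splitting the nested cases into three bands lets each band sum collapse separately. -/
theorem lanczosT_entry (j : ℕ) (a b : Fin (j + 1)) :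
    lanczosT H g j a b = (if (b : ℕ) = a then lanczosTheta H g a else 0)
      + (if (b : ℕ) = a + 1 then lanczosGamma H g b else 0)
      + (if (a : ℕ) = b + 1 then lanczosGamma H g a else 0) := by
  simp only [lanczosT, Matrix.of_apply, Fin.ext_iff]
  split_ifs <;> first | omega | simp

theorem lanczosT_column (j : ℕ) (b : Fin (j + 1)) :
    ∑ a : Fin (j + 1), lanczosT H g j a b • lanczosQ H g a
      = H (lanczosQ H g b) - if b = Fin.last j then (lanczos H g (j + 1)).2 else 0 := by
  simp only [lanczosT_entry, add_smul, Finset.sum_add_distrib, ite_smul, zero_smul]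
  rw [Fin.sum_univ_eq_sum_range
      (fun a => if (b : ℕ) = a then lanczosTheta H g a • lanczosQ H g a else 0),
    Fin.sum_univ_eq_sum_range
      (fun a => if (b : ℕ) = a + 1 then lanczosGamma H g b • lanczosQ H g a else 0),
    Fin.sum_univ_eq_sum_range
      (fun a => if a = (b : ℕ) + 1 then lanczosGamma H g a • lanczosQ H g a else 0),
    Finset.sum_ite_eq, Finset.sum_ite_eq', if_pos (Finset.mem_range.2 b.2), gamma_smul_q,
    lanczos_three_term]
  -- The superdiagonal band is empty in column `0`, which matches the convention `q_{-1} = 0`.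
  have h2 : ∑ a ∈ Finset.range (j + 1),
      (if (b : ℕ) = a + 1 then lanczosGamma H g b • lanczosQ H g a else 0)
      = lanczosGamma H g b • (lanczos H g b).1 := by
    obtain ⟨b, hb⟩ := b
    cases b with
    | zero => simp [lanczos]
    | succ b =>
      simp only [Nat.add_right_cancel_iff, Finset.sum_ite_eq]
      rw [if_pos (Finset.mem_range.2 (by omega))]
      rfl
  rw [h2]
  by_cases hb : b = Fin.last j
  · subst hb
    simp
    abel
  · have : (b : ℕ) < j := Fin.val_lt_last hb
    rw [if_neg hb, if_pos (Finset.mem_range.2 (by omega))]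
    abel

/-- This is `H Q_j = Q_j T_j + y_{j+1} e_{j+1}ᵀ`, the bridge between reduced and full space. It
needs neither symmetry of `H` nor orthonormality. -/
theorem H_applyQ {j : ℕ} (t : Vec (j + 1)) :
    H (applyQ H g t) = applyQ H g (Matrix.toEuclideanCLM (𝕜 := ℝ) (lanczosT H g j) t)
      + t (Fin.last j) • (lanczos H g (j + 1)).2 := by
  have h1 : applyQ H g (Matrix.toEuclideanCLM (𝕜 := ℝ) (lanczosT H g j) t)
      = ∑ b, t b • ∑ a, lanczosT H g j a b • lanczosQ H g a := by
    simp only [applyQ, Matrix.ofLp_toEuclideanCLM, Matrix.mulVec, dotProduct, Finset.sum_smul,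
      Finset.smul_sum]
    rw [Finset.sum_comm]
    simp only [smul_smul, mul_comm]
  rw [h1]
  simp only [lanczosT_column, smul_sub, Finset.sum_sub_distrib, smul_ite, smul_zero,
    Finset.sum_ite_eq', Finset.mem_univ, if_true, applyQ, map_sum, map_smul]
  abel

theorem applyQ_add {j : ℕ} (t u : Vec (j + 1)) :
    applyQ H g (t + u) = applyQ H g t + applyQ H g u := by
  simp [applyQ, add_smul, Finset.sum_add_distrib]

theorem applyQ_smul {j : ℕ} (c : ℝ) (t : Vec (j + 1)) :
    applyQ H g (c • t) = c • applyQ H g t := by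
  simp [applyQ, Finset.smul_sum, smul_smul]

theorem applyQ_single_zero (j : ℕ) :
    applyQ H g (lanczosGamma H g 0 • EuclideanSpace.single (0 : Fin (j + 1)) (1 : ℝ)) = g := by
  rw [applyQ_smul]
  have : applyQ H g (EuclideanSpace.single (0 : Fin (j + 1)) (1 : ℝ)) = lanczosQ H g 0 := by
    simp only [applyQ]
    rw [Finset.sum_eq_single 0]
    · simp
    · intro b _ hb; simp [hb]
    · simp
  rw [this, gamma_smul_q]
  rfl

theorem toEuclideanCLM_shiftT {j : ℕ} (lam : ℝ) (t : Vec (j + 1)) :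
    Matrix.toEuclideanCLM (𝕜 := ℝ) (shiftT H g j lam) t
      = Matrix.toEuclideanCLM (𝕜 := ℝ) (lanczosT H g j) t + lam • t := by
  simp [shiftT]

theorem inner_toEuclideanCLM_nonneg {m : ℕ} {A : Matrix (Fin m) (Fin m) ℝ} (hA : A.PosSemidef)
    (t : Vec m) : (0 : ℝ) ≤ inner ℝ t (Matrix.toEuclideanCLM (𝕜 := ℝ) A t) := by
  have := hA.dotProduct_mulVec_nonneg t.ofLp
  simpa [EuclideanSpace.inner_eq_star_dotProduct, dotProduct_comm] using this

end Lanczos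

/-! ### Reduced subproblems and their full-space meaning -/

section Subproblem

variable {H : Vec n →L[ℝ] Vec n} {g : Vec n} {j : ℕ} {t u : Vec (j + 1)} {δ lam lam' : ℝ}

/-- A solution of the regularized subproblem solves the trust-region subproblem with radius equal
to its norm. -/
theorem SolvesReg.solvesTR (h : SolvesReg H g lam t) (hlam : 0 ≤ lam) :
    SolvesTR H g ‖t‖ t lam :=
  ⟨by rw [h.2, add_neg_cancel], h.1.posSemidef, hlam, le_rfl, by simp⟩

theorem SolvesTR.ne_zero (h : SolvesTR H g δ t lam) (hg : g ≠ 0) : t ≠ 0 := by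
  rintro rfl
  have := congrArg (applyQ H g) h.1
  rw [map_zero, add_zero, applyQ_single_zero] at this
  exact hg (by simpa [applyQ] using this)

/-- The norm of the solution of the shifted system decreases with the shift. -/
theorem SolvesTR.norm_le_of_lt (h : SolvesTR H g δ t lam) {δ' : ℝ}
    (h' : SolvesTR H g δ' u lam') (hlt : lam < lam') : ‖u‖ ≤ ‖t‖ := by
  -- Since `(T + lam I)(t - u) = (lam' - lam) u`, semidefiniteness gives `⟪t - u, u⟫ ≥ 0`, that is
  -- `‖u‖² ≤ ⟪t, u⟫ ≤ ‖t‖ ‖u‖`.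
  have hpos := inner_toEuclideanCLM_nonneg h.2.1 (t - u)
  have e1 := h.1
  have e2 := h'.1
  rw [toEuclideanCLM_shiftT] at e1 e2 hpos
  have : Matrix.toEuclideanCLM (𝕜 := ℝ) (lanczosT H g j) (t - u) + lam • (t - u)
      = (lam' - lam) • u := by
    rw [map_sub, smul_sub, sub_smul]
    linear_combination (norm := module) e1 - e2
  rw [this, inner_smul_right, inner_sub_left, real_inner_self_eq_norm_sq] at hpos
  have h1 := nonneg_of_mul_nonneg_right hpos (sub_pos.2 hlt)
  have h2 := real_inner_le_norm t u
  by_contra hc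
  push Not at hc
  nlinarith [norm_nonneg t, norm_nonneg u]

/-- The full-space step of a subproblem solution solves the shifted Newton system up to a residual
that is orthogonal to the step. -/
theorem SolvesTR.newton_system (h : SolvesTR H g δ t lam)
    (hH : ∀ u v, inner ℝ (H u) v = inner ℝ u (H v)) (ho : LanczosOrtho H g j) :
    ‖H (applyQ H g t) + lam • applyQ H g t + g‖ = resid H g t ∧
      inner ℝ (applyQ H g t) (H (applyQ H g t)) + lam * ‖applyQ H g t‖ ^ 2
        = -inner ℝ (applyQ H g t) g ∧
      0 ≤ inner ℝ (applyQ H g t) (H (applyQ H g t)) + lam * ‖applyQ H g t‖ ^ 2 := by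
  have e := congrArg (applyQ H g) h.1
  rw [toEuclideanCLM_shiftT, applyQ_add, applyQ_add, applyQ_single_zero, applyQ_smul] at e
  have hz : applyQ H g (0 : Vec (j + 1)) = 0 := by simp [applyQ]
  rw [hz] at e
  -- The residual lies along `y_{j+1}`, which is orthogonal to the range of `Q_j`.
  have hr : H (applyQ H g t) + lam • applyQ H g t + g
      = t (Fin.last j) • (lanczos H g (j + 1)).2 := by
    rw [H_applyQ]
    linear_combination (norm := module) e
  have hi := congrArg (fun v => (inner ℝ (applyQ H g t) v : ℝ)) hr
  simp only [inner_add_right, inner_smul_right, real_inner_self_eq_norm_sq,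
    ho.inner_applyQ_next hH, mul_zero] at hi
  refine ⟨?_, by linarith, ?_⟩
  · rw [hr, norm_smul, mul_comm]; rfl
  · have hpos := inner_toEuclideanCLM_nonneg h.2.1 t
    rw [toEuclideanCLM_shiftT, ← ho.inner_applyQ, applyQ_add, applyQ_smul, inner_add_right,
      inner_smul_right, real_inner_self_eq_norm_sq] at hpos
    rw [H_applyQ, inner_add_right, inner_smul_right, ho.inner_applyQ_next hH, mul_zero, add_zero]
    exact hpos

end Subproblem

/-! ### Symmetry of the Hessian and Taylor estimates -/

section Smooth

variable {f : Vec n → ℝ}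

theorem inner_gradient (x v : Vec n) : inner ℝ (gradient f x) v = fderiv ℝ f x v := by
  simp [gradient]

theorem contDiff_gradient (hf : ContDiff ℝ 2 f) : ContDiff ℝ 1 (gradient f) :=
  (InnerProductSpace.toDual ℝ (Vec n)).symm.toContinuousLinearEquiv.contDiff.comp
    (hf.fderiv_right (m := 1) (by norm_num))

theorem hasFDerivAt_gradient (hf : ContDiff ℝ 2 f) (x : Vec n) :
    HasFDerivAt (gradient f) (hess f x) x :=
  ((contDiff_gradient hf).differentiable (by norm_num) x).hasFDerivAt

theorem continuous_hess (hf : ContDiff ℝ 2 f) : Continuous (hess f) :=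
  (contDiff_gradient hf).continuous_fderiv (by norm_num)

/-- Both sides are the derivative of `y ↦ ⟪∇f y, v⟫`; self-adjointness of `hess` then follows from
symmetry of the second derivative. -/
theorem inner_hess (hf : ContDiff ℝ 2 f) (x u v : Vec n) :
    inner ℝ (hess f x u) v = fderiv ℝ (fderiv ℝ f) x u v := by
  have h1 : HasFDerivAt (fun y => (inner ℝ (gradient f y) v : ℝ))
      ((innerSL ℝ v).comp (hess f x)) x := by
    have := (innerSL ℝ v).hasFDerivAt.comp x (hasFDerivAt_gradient hf x)
    refine this.congr_of_eventuallyEq (Eventually.of_forall fun y => ?_)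
    exact real_inner_comm _ _
  have h2 : HasFDerivAt (fun y => fderiv ℝ f y v)
      ((ContinuousLinearMap.apply ℝ ℝ v).comp (fderiv ℝ (fderiv ℝ f) x)) x :=
    (ContinuousLinearMap.apply ℝ ℝ v).hasFDerivAt.comp x
      (((hf.fderiv_right (m := 1) (by norm_num)).differentiable (by norm_num) x).hasFDerivAt)
  simp only [inner_gradient] at h1
  have h3 := congrArg (fun A : Vec n →L[ℝ] ℝ => A u) (h1.unique h2)
  simpa [real_inner_comm] using h3

theorem hess_symm (hf : ContDiff ℝ 2 f) (x u v : Vec n) :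
    inner ℝ (hess f x u) v = (inner ℝ u (hess f x v) : ℝ) := by
  rw [real_inner_comm _ u, inner_hess hf, inner_hess hf]
  exact (hf.contDiffAt.isSymmSndFDerivAt (by simp)).eq u v

variable {U : Set (Vec n)} {L : NNReal}

/-- Mean value inequality on the segment, where the Hessian varies by at most `L ‖s‖`. The sharp
factor `1 / 2` is not needed. -/
theorem norm_gradient_sub_le (hf : ContDiff ℝ 2 f) (hU : Convex ℝ U)
    (hL : LipschitzOnWith L (hess f) U) {x s : Vec n} (hx : x ∈ U) (hs : x + s ∈ U) :
    ‖gradient f (x + s) - gradient f x - hess f x s‖ ≤ L * ‖s‖ ^ 2 := by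
  have hseg : segment ℝ x (x + s) ⊆ U := hU.segment_subset hx hs
  have := (convex_segment (𝕜 := ℝ) x (x + s)).norm_image_sub_le_of_norm_hasFDerivWithin_le'
    (f := gradient f) (f' := hess f) (φ := hess f x) (C := L * ‖s‖)
    (fun y _ => (hasFDerivAt_gradient hf y).hasFDerivWithinAt) (fun y hy => ?_)
    (left_mem_segment ℝ _ _) (right_mem_segment ℝ _ _)
  · rw [add_sub_cancel_left] at this
    linarith [this, show (L : ℝ) * ‖s‖ * ‖s‖ = L * ‖s‖ ^ 2 by ring]
  · have h1 := hL.norm_sub_le (hseg hy) hx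
    have h2 : ‖y - x‖ ≤ ‖s‖ := by
      have := norm_sub_le_of_mem_segment hy
      simpa using this
    exact h1.trans (mul_le_mul_of_nonneg_left h2 L.2)

theorem taylor_upper_bound (hf : ContDiff ℝ 2 f) (hU : Convex ℝ U)
    (hL : LipschitzOnWith L (hess f) U) {x s : Vec n} (hx : x ∈ U) (hs : x + s ∈ U) :
    f (x + s) ≤ f x + inner ℝ s (gradient f x) + inner ℝ s (hess f x s) / 2 + L * ‖s‖ ^ 3 := by
  -- Subtracting the quadratic model along the segment leaves a function whose derivative is `s`
  -- paired with the gradient remainder.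
  let φ : ℝ → ℝ := fun r => f (x + r • s) - r * inner ℝ s (gradient f x)
    - r ^ 2 * (inner ℝ s (hess f x s) / 2)
  have hφ : ∀ r, HasDerivAt φ (inner ℝ s (gradient f (x + r • s) - gradient f x
      - hess f x (r • s))) r := by
    intro r
    have h1 : HasDerivAt (fun r : ℝ => f (x + r • s)) (fderiv ℝ f (x + r • s) s) r := by
      have hl : HasDerivAt (fun r : ℝ => x + r • s) s r := by
        simpa using ((hasDerivAt_id r).smul_const s).const_add x
      exact ((hf.differentiable (by norm_num) (x + r • s)).hasFDerivAt).comp_hasDerivAt r hl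
    have h2 := (h1.sub ((hasDerivAt_id r).mul_const (inner ℝ s (gradient f x)))).sub
      ((hasDerivAt_pow 2 r).mul_const (inner ℝ s (hess f x s) / 2))
    refine h2.congr_deriv ?_
    rw [inner_sub_right, inner_sub_right, map_smul, inner_smul_right,
      real_inner_comm (gradient f (x + r • s)), inner_gradient]
    simp
    ring
  have := (convex_Icc (0 : ℝ) 1).norm_image_sub_le_of_norm_hasDerivWithin_le
    (f := φ) (C := L * ‖s‖ ^ 3) (fun r _ => (hφ r).hasDerivWithinAt) (fun r hr => ?_)
    (Set.left_mem_Icc.2 zero_le_one) (Set.right_mem_Icc.2 zero_le_one)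
  · have h3 := (le_abs_self _).trans this
    have h4 : (inner ℝ s (gradient f x) : ℝ) = fderiv ℝ f x s := by
      rw [real_inner_comm, inner_gradient]
    simp [φ] at h3
    linarith
  · have hmem : x + r • s ∈ U := hU.add_smul_mem hx hs hr
    have h4 := norm_gradient_sub_le hf hU hL hx hmem
    refine (norm_inner_le_norm _ _).trans ?_
    have h5 : ‖r • s‖ ≤ ‖s‖ := by
      rw [norm_smul, Real.norm_eq_abs, abs_of_nonneg hr.1]
      exact mul_le_of_le_one_left (norm_nonneg _) hr.2
    calc ‖s‖ * _ ≤ ‖s‖ * (L * ‖s‖ ^ 2) := by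
          gcongr
          exact h4.trans (by gcongr)
      _ = L * ‖s‖ ^ 3 := by ring

end Smooth

/-! ### Local behaviour at a point with positive definite Hessian -/

section Local

variable {f : Vec n → ℝ} {xs : Vec n}

/-- A positive definite operator is uniformly positive definite. -/
theorem exists_pos_forall_inner_ge {A : Vec n →L[ℝ] Vec n}
    (hA : ∀ v, v ≠ 0 → (0 : ℝ) < inner ℝ v (A v)) :
    ∃ m : ℝ, 0 < m ∧ ∀ v, m * ‖v‖ ^ 2 ≤ inner ℝ v (A v) := by
  rcases isEmpty_or_nonempty (Metric.sphere (0 : Vec n) 1) with he | ⟨⟨w, hw⟩⟩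
  -- The unit sphere is empty exactly when the space is trivial; otherwise compactness supplies a
  -- minimum.
  · refine ⟨1, one_pos, fun v => ?_⟩
    by_cases hv : v = 0
    · simp [hv]
    · exact (he.false ⟨‖v‖⁻¹ • v, by simp [norm_smul, hv]⟩).elim
  · obtain ⟨w, hw, hmin⟩ := (isCompact_sphere (0 : Vec n) 1).exists_isMinOn ⟨w, hw⟩
      (f := fun v => (inner ℝ v (A v) : ℝ)) (by fun_prop)
    have hw1 : ‖w‖ = 1 := by simpa using hw
    refine ⟨inner ℝ w (A w), hA w (norm_ne_zero_iff.1 (by simp [hw1])), fun v => ?_⟩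
    by_cases hv : v = 0
    · simp [hv]
    · have h := hmin (show ‖v‖⁻¹ • v ∈ Metric.sphere (0 : Vec n) 1 by simp [norm_smul, hv])
      simp only [Set.mem_ofPred_eq, map_smul, inner_smul_left, inner_smul_right] at h
      have hv' : 0 < ‖v‖ := norm_pos_iff.2 hv
      calc _ ≤ _ := mul_le_mul_of_nonneg_right h (by positivity)
        _ = inner ℝ v (A v) := by
          simp
          field_simp

/-- Near a point with positive definite Hessian, the Hessian is uniformly positive definite. -/
theorem eventually_inner_hess_ge (hf : ContDiff ℝ 2 f)
    (hpos : ∀ v : Vec n, v ≠ 0 → (0 : ℝ) < inner ℝ v (hess f xs v)) :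
    ∃ m : ℝ, 0 < m ∧ ∀ᶠ x in 𝓝 xs, ∀ v, m * ‖v‖ ^ 2 ≤ inner ℝ v (hess f x v) := by
  obtain ⟨m, hm, hmin⟩ := exists_pos_forall_inner_ge hpos
  refine ⟨m / 2, by positivity, ?_⟩
  filter_upwards [(continuous_hess hf).continuousAt.eventually (Metric.ball_mem_nhds _
    (half_pos hm))] with x hx v
  have h1 : ‖hess f x - hess f xs‖ ≤ m / 2 := by
    rw [← dist_eq_norm]; exact (Metric.mem_ball.1 hx).le
  have h2 : |inner ℝ v ((hess f x - hess f xs) v)| ≤ m / 2 * ‖v‖ ^ 2 := by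
    refine (abs_real_inner_le_norm _ _).trans ?_
    have := (hess f x - hess f xs).le_of_opNorm_le h1 v
    nlinarith [norm_nonneg v]
  rw [sub_apply, inner_sub_right] at h2
  linarith [abs_le.1 h2, hmin v]

/-- Near a stationary point with positive definite Hessian, the norm of the gradient is comparable
to the distance to that point. -/
theorem eventually_norm_gradient_comparable (hf : ContDiff ℝ 2 f) (hgs : gradient f xs = 0)
    (hpos : ∀ v : Vec n, v ≠ 0 → (0 : ℝ) < inner ℝ v (hess f xs v)) :
    ∃ m M : ℝ, 0 < m ∧ 0 < M ∧
      ∀ᶠ x in 𝓝 xs, m * ‖x - xs‖ ≤ ‖gradient f x‖ ∧ ‖gradient f x‖ ≤ M * ‖x - xs‖ := by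
  obtain ⟨m, hm, hmin⟩ := exists_pos_forall_inner_ge hpos
  refine ⟨m / 2, ‖hess f xs‖ + m / 2, by positivity, by positivity, ?_⟩
  filter_upwards [(hasFDerivAt_gradient hf xs).isLittleO.def (half_pos hm)] with x hx
  rw [hgs, sub_zero] at hx
  have h1 := (hess f xs).le_opNorm (x - xs)
  have h2 : m * ‖x - xs‖ ≤ ‖hess f xs (x - xs)‖ := by
    have h3 := (hmin (x - xs)).trans (real_inner_le_norm _ _)
    rcases (norm_nonneg (x - xs)).eq_or_lt with h0 | h0
    · rw [← h0, mul_zero]; positivity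
    · exact le_of_mul_le_mul_left (by linarith) h0
  have h4 := norm_sub_norm_le (gradient f x) (hess f xs (x - xs))
  have h5 := norm_sub_norm_le (hess f xs (x - xs)) (gradient f x)
  rw [norm_sub_rev] at h5
  constructor <;> linarith

end Local

/-! ### Two convergence lemmas for sequences -/

section Sequences

/-- If `0 ≤ a (k+1) ≤ b k + e k * a k` with `b, e → 0` then `a → 0`. -/
theorem tendsto_zero_of_recursion {a b e : ℕ → ℝ} (ha : ∀ k, 0 ≤ a k)
    (hrec : ∀ k, a (k + 1) ≤ b k + e k * a k) (hb : Tendsto b atTop (𝓝 0))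
    (he : Tendsto e atTop (𝓝 0)) : Tendsto a atTop (𝓝 0) := by
  obtain ⟨N, hN⟩ := eventually_atTop.1 (he.eventually_lt_const (show (0 : ℝ) < 1 / 2 by norm_num))
  rw [Metric.tendsto_atTop]
  intro ε hε
  obtain ⟨N', hN'⟩ := eventually_atTop.1 (hb.eventually_lt_const (show (0 : ℝ) < ε / 4 by linarith))
  set K := max N N' with hK
  -- From `K` on, `e < 1/2` and `b < ε/4`, and `ε/2` is the fixed point of `a ↦ ε/4 + a/2`.
  have hstep : ∀ i, a (K + i) ≤ ε / 2 + (1 / 2) ^ i * a K := by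
    intro i
    induction i with
    | zero => simp; positivity
    | succ i ih =>
      have h1 := hrec (K + i)
      have h2 := hN (K + i) (by omega)
      have h3 := hN' (K + i) (by omega)
      have h4 : e (K + i) * a (K + i) ≤ 1 / 2 * a (K + i) :=
        mul_le_mul_of_nonneg_right h2.le (ha _)
      rw [← add_assoc, pow_succ]
      linarith
  have hlim : Tendsto (fun i : ℕ => (1 / 2 : ℝ) ^ i * a K) atTop (𝓝 0) := by
    simpa using (tendsto_pow_atTop_nhds_zero_of_lt_one (r := (1 / 2 : ℝ)) (by norm_num)
      (by norm_num)).mul_const (a K)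
  obtain ⟨N'', hN''⟩ := eventually_atTop.1 (hlim.eventually_lt_const (half_pos hε))
  refine ⟨K + N'', fun k hk => ?_⟩
  obtain ⟨i, rfl⟩ : ∃ i, k = K + i := ⟨k - K, by omega⟩
  rw [Real.dist_eq, sub_zero, abs_of_nonneg (ha _)]
  linarith [hstep i, hN'' i (by omega)]

/-- A sequence with vanishing steps, a cluster point at which a continuous quantity vanishing along
the sequence grows linearly, converges to that cluster point. -/
theorem tendsto_of_isolated_cluster {E : Type*} [NormedAddCommGroup E] {x : ℕ → E} {xs : E}
    {φ : ℕ → ℕ} (hφ : StrictMono φ) (hx : Tendsto (x ∘ φ) atTop (𝓝 xs))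
    (hs : Tendsto (fun k => ‖x (k + 1) - x k‖) atTop (𝓝 0)) {G : E → ℝ}
    (hG : Tendsto (fun k => G (x k)) atTop (𝓝 0)) {m : ℝ} (hm : 0 < m)
    (hloc : ∀ᶠ y in 𝓝 xs, m * ‖y - xs‖ ≤ G y) : Tendsto x atTop (𝓝 xs) := by
  obtain ⟨r, hr, hball⟩ := Metric.eventually_nhds_iff.1 hloc
  rw [Metric.tendsto_atTop]
  intro ε hε
  set d := min (r / 2) ε with hd
  have hd0 : 0 < d := lt_min (by positivity) hε
  have hdr : d ≤ r / 2 := min_le_left _ _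
  obtain ⟨N, hN⟩ := eventually_atTop.1 ((hs.eventually_lt_const (show 0 < r / 2 by positivity)).and
    (hG.eventually_lt_const (show 0 < m * d by positivity)))
  obtain ⟨i, hi, hiN⟩ := ((hx.eventually (Metric.ball_mem_nhds xs hd0)).and
    (eventually_ge_atTop N)).exists
  refine ⟨φ i, fun k hk => lt_of_lt_of_le ?_ (min_le_right (r / 2) ε)⟩
  change dist (x k) xs < d
  -- A step shorter than `r/2` from the `d`-ball stays in the `r`-ball, where smallness of `G` pulls
  -- the point back into the `d`-ball.
  induction k, hk using Nat.le_induction with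
  | base => exact hi
  | succ k hk ih =>
    have hkN : N ≤ k := (hiN.trans (hφ.id_le i)).trans hk
    have h1 : dist (x (k + 1)) xs < r := by
      have := dist_triangle (x (k + 1)) (x k) xs
      have h2 := (hN k hkN).1
      rw [← dist_eq_norm] at h2
      linarith
    have h3 := (hball h1).trans_lt (hN (k + 1) (by omega)).2
    rw [dist_eq_norm]
    exact lt_of_mul_lt_mul_left h3 hm.le

end Sequences

/-! ### Multiplier and ratio bounds inside "find decrease step" -/

section FindDecreaseStep

variable {P : Params} {f : Vec n → ℝ} {x : Vec n} {j : ℕ} {U : Set (Vec n)} {L : NNReal}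

/-- A trial step with insufficient decrease has a multiplier that is small relative to the step. -/
theorem lam_le_of_decRatio_lt (hf : ContDiff ℝ 2 f) (hU : Convex ℝ U)
    (hL : LipschitzOnWith L (hess f) U) (hg : gradient f x ≠ 0)
    (ho : LanczosOrtho (hess f x) (gradient f x) j) {a : FDSState j} (hx : x ∈ U)
    (hs : x + a.step f x ∈ U)
    (ha : SolvesTR (hess f x) (gradient f x) a.δ a.t a.lam)
    (hρ : decRatio f x (a.step f x) < P.η) : a.lam ≤ (2 * P.η + 2 * L) * ‖a.t‖ := by
  have hT := taylor_upper_bound hf hU hL hx hs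
  obtain ⟨-, h1, h2⟩ := ha.newton_system (hess_symm hf x) ho
  change _ = -inner ℝ (a.step f x) (gradient f x) at h1
  change 0 ≤ inner ℝ (a.step f x) (hess f x (a.step f x)) + a.lam * ‖a.step f x‖ ^ 2 at h2
  change inner ℝ (a.step f x) (hess f x (a.step f x)) + a.lam * ‖a.step f x‖ ^ 2 = _ at h1
  have hn : ‖a.step f x‖ = ‖a.t‖ := ho.norm_applyQ _
  have ht : 0 < ‖a.t‖ := norm_pos_iff.2 (ha.ne_zero hg)
  rw [decRatio, div_lt_iff₀ (by rw [hn]; positivity)] at hρ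
  rw [hn] at hT h1 h2 hρ
  -- Optimality and Taylor bound the decrease below by `(sᵀHs + lam ‖s‖²)/2 + lam ‖s‖²/2 - L ‖s‖³`,
  -- whose first term is nonnegative; rejection bounds it above by `η ‖s‖³`.
  have h3 : a.lam * ‖a.t‖ ^ 2 ≤ ((2 * P.η + 2 * L) * ‖a.t‖) * ‖a.t‖ ^ 2 := by nlinarith
  exact le_of_mul_le_mul_right h3 (by positivity)

/-- One pass of "find decrease step" keeps the optimality conditions and a uniform bound on the
ratio parameter. -/
theorem FDSStep.invariant {a b : FDSState j} (hstep : FDSStep P f x a b)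
    (hg : gradient f x ≠ 0) {C : ℝ}
    (ha : SolvesTR (hess f x) (gradient f x) a.δ a.t a.lam)
    (hC : decRatio f x (a.step f x) < P.η → a.lam ≤ C * ‖a.t‖) :
    SolvesTR (hess f x) (gradient f x) b.δ b.t b.lam ∧
      b.σ ≤ max a.σ (max P.σhi (P.γL / P.γC * C)) := by
  have ht : 0 < ‖a.t‖ := norm_pos_iff.2 (ha.ne_zero hg)
  have hγL : 0 < P.γL := one_pos.trans P.γL_gt
  have hγC := P.γC_pos
  -- In the `γL`/`γC` contractions the multiplier grows by at most `γL` and the norm shrinks by at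
  -- most `γC`.
  have key : ∀ {lam nb : ℝ}, decRatio f x (a.step f x) < P.η → lam ≤ P.γL * a.lam →
      P.γC * a.δ ≤ nb → lam / nb ≤ P.γL / P.γC * C := by
    intro lam nb hρ h1 h2
    have h3 : P.γC * ‖a.t‖ ≤ nb := (mul_le_mul_of_nonneg_left ha.2.2.2.1 hγC.le).trans h2
    have h4 : 0 < nb := (mul_pos hγC ht).trans_le h3
    have h0 := ha.2.2.1
    have hC0 : 0 ≤ C := nonneg_of_mul_nonneg_left (h0.trans (hC hρ)) ht
    rw [div_le_iff₀ h4]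
    calc lam ≤ P.γL * (C * ‖a.t‖) := h1.trans (mul_le_mul_of_nonneg_left (hC hρ) hγL.le)
      _ = P.γL / P.γC * C * (P.γC * ‖a.t‖) := by field_simp
      _ ≤ _ := mul_le_mul_of_nonneg_left h3 (by positivity)
  cases hstep with
  | expand hρ hσ hδ' hsolve hσ' => exact ⟨hsolve, hσ'.le.trans (le_max_left _ _)⟩
  | contractSmall hρ hsmall hlam' hsolve htest hδ' hσ' =>
    refine ⟨?_, ?_⟩
    · rw [hδ']
      exact hsolve.solvesTR (hlam' ▸ add_nonneg ha.2.2.1 (Real.sqrt_nonneg _))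
    · rw [hσ']
      exact max_le_max le_rfl (htest.trans (le_max_left _ _))
  | contractBetween lamHat tHat hρ hsmall hlamHat hsolveHat htest hlo hhi hsolve hr1 hr2 hδ' hσ' =>
    refine ⟨?_, ?_⟩
    · rw [hδ']
      exact hsolve.solvesTR (ha.2.2.1.trans hlo.le)
    · rw [hσ']
      exact max_le_max le_rfl (hr2.le.trans (le_max_left _ _))
  | contractLarge hρ hlarge hlam' hsolve htest hδ' hσ' =>
    refine ⟨?_, ?_⟩
    · rw [hδ']
      exact hsolve.solvesTR (hlam' ▸ mul_nonneg hγL.le ha.2.2.1)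
    · rw [hσ']
      exact max_le_max le_rfl ((key hρ hlam'.le htest).trans (le_max_right _ _))
  | contractRadius tHat hρ hlarge hsolveHat htest hδ' hsolve hσ' =>
    refine ⟨hsolve, ?_⟩
    rw [hσ']
    refine max_le_max le_rfl (le_trans ?_ (le_max_right _ _))
    have h0 : 0 ≤ P.γL * a.lam := mul_nonneg hγL.le ha.2.2.1
    obtain ⟨-, -, hb0, -, hcomp⟩ := id hsolve
    rcases hb0.eq_or_lt with hb | hb
    · rw [← hb, zero_div]
      have hC0 : 0 ≤ C := nonneg_of_mul_nonneg_left (ha.2.2.1.trans (hC hρ)) ht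
      positivity
    · have hnorm : b.δ = ‖b.t‖ := by
        rcases mul_eq_zero.1 hcomp with h | h <;> linarith
      refine key hρ ?_ (by rw [← hnorm, hδ'])
      -- A multiplier above `γL * a.lam` would give, by monotonicity, `‖b.t‖ ≤ ‖tHat‖ < γC * a.δ =
      -- ‖b.t‖`.
      by_contra hlt
      push Not at hlt
      have := (hsolveHat.solvesTR h0).norm_le_of_lt hsolve hlt
      linarith

end FindDecreaseStep

/-! ### Bounds along a run and the local recursion -/

namespace Trace

variable {P : Params} {f : Vec n → ℝ} {τ : ℕ → ℕ → ℝ} {R : Trace n}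

theorem resid_eq_zero {H : Vec n →L[ℝ] Vec n} {g : Vec n} {j : ℕ}
    (h : lanczosGamma H g (j + 1) = 0) (t : Vec (j + 1)) : resid H g t = 0 := by
  rw [resid, h, zero_mul]

/-- The Lanczos process does not break down before the accepted index. -/
theorem IsRun.gamma_ne_zero (hR : R.IsRun P f τ) (hτ : ∀ k j, 0 ≤ τ k j)
    (hg : ∀ k, gradient f (R.x k) ≠ 0) {k i : ℕ} (hi : i ≤ R.jLast k) :
    lanczosGamma (hess f (R.x k)) (gradient f (R.x k)) i ≠ 0 := by
  cases i with
  | zero => exact norm_ne_zero_iff.2 (hg k)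
  | succ i =>
    intro h0
    -- On breakdown every residual in dimension `i + 1` vanishes, so all tests pass and the Krylov
    -- dimension would not have grown past `i`.
    have hpass : ∀ (t : Vec (i + 1)) (lam : ℝ),
        TermTest P (hess f (R.x k)) (gradient f (R.x k)) t lam := fun t lam =>
      Or.inl (by rw [resid_eq_zero h0]; exact mul_nonneg P.ξ₁_pos.le (sq_nonneg _))
    rcases lt_or_ge i (R.jFirst k) with h | h
    · exact hR.tltr_continue k i h (hpass _ _)
    · exact hR.reject k i h (by omega) ⟨hpass _ _, by rw [resid_eq_zero h0]; exact hτ k i⟩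

theorem IsRun.ortho (hR : R.IsRun P f τ) (hτ : ∀ k j, 0 ≤ τ k j)
    (hg : ∀ k, gradient f (R.x k) ≠ 0) (hf : ContDiff ℝ 2 f) {k j : ℕ} (hj : j ≤ R.jLast k) :
    LanczosOrtho (hess f (R.x k)) (gradient f (R.x k)) j :=
  lanczosOrtho (hess_symm hf _) j fun _ hi => hR.gamma_ne_zero hτ hg (hi.trans hj)

variable {U : Set (Vec n)} {L : NNReal}

theorem IsRun.fds_invariant (hR : R.IsRun P f τ) (hτ : ∀ k j, 0 ≤ τ k j)
    (hg : ∀ k, gradient f (R.x k) ≠ 0) (hf : ContDiff ℝ 2 f) (hU : Convex ℝ U)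
    (hL : LipschitzOnWith L (hess f) U) (hx : ∀ k, R.x k ∈ U)
    (hs : ∀ k j l, R.Generated k j l → R.x k + (R.fds k j l).step f (R.x k) ∈ U)
    (k j l : ℕ) (h : R.Generated k j l) :
    SolvesTR (hess f (R.x k)) (gradient f (R.x k)) (R.fds k j l).δ (R.fds k j l).t
        (R.fds k j l).lam ∧
      (R.fds k j l).σ ≤ max (R.σ k) (max P.σhi (P.γL / P.γC * (2 * P.η + 2 * L))) := by
  induction l with
  | zero =>
    rw [hR.fds_start k j h.1 h.2.1]
    exact ⟨hR.sub_solves k j h.2.1, le_max_left _ _⟩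
  | succ l ih =>
    have h' : R.Generated k j l := ⟨h.1, h.2.1, by have := h.2.2; omega⟩
    obtain ⟨ih1, ih2⟩ := ih h'
    obtain ⟨h1, h2⟩ := (hR.fds_step k j l h.1 h.2.1 h.2.2).invariant (hg k) ih1
      (lam_le_of_decRatio_lt hf hU hL (hg k) (hR.ortho hτ hg hf h.2.1) (hx k) (hs k j l h') ih1)
    exact ⟨h1, h2.trans (max_le ih2 (le_max_right _ _))⟩

theorem generated_out (hR : R.IsRun P f τ) (k : ℕ) :
    R.Generated k (R.jLast k) (R.lLast k (R.jLast k)) :=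
  ⟨hR.first_le_last k, le_rfl, le_rfl⟩

/-- The bound in `fds_invariant` is a maximum with a constant independent of `k`, so it does not
accumulate over iterations. -/
theorem IsRun.sigma_le (hR : R.IsRun P f τ) (hτ : ∀ k j, 0 ≤ τ k j)
    (hg : ∀ k, gradient f (R.x k) ≠ 0) (hf : ContDiff ℝ 2 f) (hU : Convex ℝ U)
    (hL : LipschitzOnWith L (hess f) U) (hx : ∀ k, R.x k ∈ U)
    (hs : ∀ k j l, R.Generated k j l → R.x k + (R.fds k j l).step f (R.x k) ∈ U) (k : ℕ) :
    R.σ k ≤ max P.σhi (P.γL / P.γC * (2 * P.η + 2 * L)) := by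
  induction k with
  | zero => exact hR.σ_zero.2.trans (le_max_left _ _)
  | succ k ih =>
    rw [hR.σ_succ]
    exact (hR.fds_invariant hτ hg hf hU hL hx hs _ _ _ (generated_out hR k)).2.trans
      (max_le ih le_rfl)

/-- Properties of the accepted steps that drive the convergence analysis. -/
theorem IsRun.accepted_step_bounds (hR : R.IsRun P f τ) (hτ : ∀ k j, 0 ≤ τ k j)
    (hg : ∀ k, gradient f (R.x k) ≠ 0) (hf : ContDiff ℝ 2 f) (hU : Convex ℝ U)
    (hL : LipschitzOnWith L (hess f) U) (hx : ∀ k, R.x k ∈ U)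
    (hs : ∀ k j l, R.Generated k j l → R.x k + (R.fds k j l).step f (R.x k) ∈ U) :
    ∃ C : ℝ, 0 ≤ C ∧ ∀ k, ∃ μ : ℝ,
      P.η * ‖R.acceptedStep f k‖ ^ 3 ≤ f (R.x k) - f (R.x (k + 1)) ∧
      ‖gradient f (R.x (k + 1))‖ ≤ C * ‖R.acceptedStep f k‖ ^ 2 + μ ∧
      μ ≤ P.ξ₁ * ‖R.acceptedStep f k‖ ^ 2
        + P.ξ₂ * ‖R.acceptedStep f k‖ * ‖gradient f (R.x k)‖ ∧
      μ ≤ τ k (R.jLast k) ∧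
      inner ℝ (R.acceptedStep f k) (hess f (R.x k) (R.acceptedStep f k))
        ≤ ‖R.acceptedStep f k‖ * ‖gradient f (R.x k)‖ := by
  set S := max P.σhi (P.γL / P.γC * (2 * P.η + 2 * L)) with hS
  have hS0 : 0 ≤ S := (P.σlo_pos.trans P.σlo_lt).le.trans (le_max_left _ _)
  refine ⟨L + S, by positivity, fun k => ?_⟩
  have hgen := generated_out hR k
  have ho := hR.ortho hτ hg hf (le_refl (R.jLast k))
  obtain ⟨hsol, hσ⟩ := hR.fds_invariant hτ hg hf hU hL hx hs _ _ _ hgen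
  change SolvesTR _ _ (R.out k (R.jLast k)).δ (R.out k (R.jLast k)).t
    (R.out k (R.jLast k)).lam at hsol
  change (R.out k (R.jLast k)).σ ≤ _ at hσ
  have hσ' := hσ.trans (max_le (hR.sigma_le hτ hg hf hU hL hx hs k) le_rfl)
  obtain ⟨hdec, hratio⟩ := hR.fds_done k (R.jLast k) (hR.first_le_last k) le_rfl
  obtain ⟨hterm, hadd⟩ := hR.accept k
  have hxs : R.x k + R.acceptedStep f k ∈ U := hs _ _ _ hgen
  have hn : ‖R.acceptedStep f k‖ = ‖(R.out k (R.jLast k)).t‖ := ho.norm_applyQ _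
  have ht : 0 < ‖(R.out k (R.jLast k)).t‖ := norm_pos_iff.2 (hsol.ne_zero (hg k))
  obtain ⟨hr1, hr2, -⟩ := hsol.newton_system (hess_symm hf _) ho
  change ‖hess f (R.x k) (R.acceptedStep f k) + (R.out k (R.jLast k)).lam • R.acceptedStep f k
    + gradient f (R.x k)‖ = _ at hr1
  change inner ℝ (R.acceptedStep f k) (hess f (R.x k) (R.acceptedStep f k))
    + _ * ‖R.acceptedStep f k‖ ^ 2 = -inner ℝ (R.acceptedStep f k) _ at hr2
  change P.η ≤ decRatio f (R.x k) (R.acceptedStep f k) at hdec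
  have hlam0 := hsol.2.2.1
  have hlam : (R.out k (R.jLast k)).lam ≤ S * ‖R.acceptedStep f k‖ := by
    rw [hn]
    exact (div_le_iff₀ ht).1 (hratio.trans hσ')
  refine ⟨resid (hess f (R.x k)) (gradient f (R.x k)) (R.out k (R.jLast k)).t, ?_, ?_, ?_, hadd, ?_⟩
  · rw [hR.x_succ]
    exact (le_div_iff₀ (by rw [hn]; positivity)).1 hdec
  · rw [hR.x_succ, ← hr1]
    have hT := norm_gradient_sub_le hf hU hL (hx k) hxs
    set s := R.acceptedStep f k
    set lam := (R.out k (R.jLast k)).lam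
    -- Taylor remainder, plus Newton residual of norm `μ`, minus the shift; the first and last are
    -- `O(‖s‖²)` with constants `L` and `S`.
    have e : gradient f (R.x k + s) = (gradient f (R.x k + s) - gradient f (R.x k)
        - hess f (R.x k) s) + (hess f (R.x k) s + lam • s + gradient f (R.x k)) - lam • s := by
      abel
    have h1 : ‖lam • s‖ ≤ S * ‖s‖ ^ 2 := by
      rw [norm_smul, Real.norm_of_nonneg hlam0]
      nlinarith [norm_nonneg s]
    calc ‖gradient f (R.x k + s)‖ ≤ _ + _ + ‖lam • s‖ := by
          conv_lhs => rw [e]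
          exact (norm_sub_le _ _).trans (add_le_add (norm_add_le _ _) le_rfl)
      _ ≤ _ := by linarith
  · rw [hn]
    have h1 : 0 ≤ P.ξ₂ * ‖(R.out k (R.jLast k)).t‖ * ‖gradient f (R.x k)‖ :=
      mul_nonneg (mul_nonneg P.ξ₂_pos.le ht.le) (norm_nonneg _)
    have h2 : 0 ≤ P.ξ₁ * ‖(R.out k (R.jLast k)).t‖ ^ 2 := mul_nonneg P.ξ₁_pos.le (sq_nonneg _)
    rcases hterm with h | ⟨h, -⟩
    · linarith
    · have h3 : P.ξ₂ * min 1 ‖(R.out k (R.jLast k)).t‖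
          * lanczosGamma (hess f (R.x k)) (gradient f (R.x k)) 0
          ≤ P.ξ₂ * ‖(R.out k (R.jLast k)).t‖ * ‖gradient f (R.x k)‖ :=
        mul_le_mul_of_nonneg_right
          (mul_le_mul_of_nonneg_left (min_le_right _ _) P.ξ₂_pos.le) (norm_nonneg _)
      linarith
  -- The term `lam ‖s‖²` has the favourable sign and is dropped.
  · have h1 := neg_le_of_abs_le (abs_real_inner_le_norm (R.acceptedStep f k) (gradient f (R.x k)))
    have h2 := mul_nonneg hlam0 (sq_nonneg ‖R.acceptedStep f k‖)
    linarith

/-- `F` is antitone and bounded below, hence convergent, so its successive differences vanish. -/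
theorem tendsto_of_sum_bounded {F b : ℕ → ℝ} (hF : BddBelow (Set.range F))
    (hb : ∀ k, 0 ≤ b k) (h : ∀ k, b k ≤ F k - F (k + 1)) : Tendsto b atTop (𝓝 0) := by
  have hanti : Antitone F := antitone_nat_of_succ_le fun k => by linarith [hb k, h k]
  have hlim := tendsto_atTop_ciInf hanti hF
  have h2 : Tendsto (fun k => F k - F (k + 1)) atTop (𝓝 0) := by
    simpa using hlim.sub (hlim.comp (tendsto_add_atTop_nat 1))
  exact squeeze_zero hb h h2

/-- The distances to the limit point satisfy the recursion from which both rates follow. -/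
theorem IsRun.local_recursion (hR : R.IsRun P f τ) (hτ : ∀ k j, 0 ≤ τ k j)
    (hf : R.StandingAssumption f) (hg : ∀ k, gradient f (R.x k) ≠ 0) {xs : Vec n}
    (hsub : ∃ φ : ℕ → ℕ, StrictMono φ ∧ Tendsto (fun i => R.x (φ i)) atTop (𝓝 xs))
    (hpos : ∀ v : Vec n, v ≠ 0 → 0 < inner ℝ v (hess f xs v)) :
    Tendsto R.x atTop (𝓝 xs) ∧ ∃ A B M : ℝ, 0 < B ∧ 0 < M ∧ ∀ᶠ k in atTop,
      ‖R.x (k + 1) - xs‖ ≤ A * ‖R.x k - xs‖ ^ 2 + B * τ k (R.jLast k) ∧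
      ‖gradient f (R.x k)‖ ≤ M * ‖R.x k - xs‖ := by
  obtain ⟨hC2, hbdd, U, -, hU, hx, hs, -, L, hL⟩ := hf
  obtain ⟨φ, hφ, hφlim⟩ := hsub
  obtain ⟨C, hC0, hC⟩ := hR.accepted_step_bounds hτ hg hC2 hU hL hx hs
  have hs3 : Tendsto (fun k => P.η * ‖R.acceptedStep f k‖ ^ 3) atTop (𝓝 0) :=
    tendsto_of_sum_bounded (F := fun k => f (R.x k))
      (hbdd.mono (by rintro _ ⟨k, rfl⟩; exact ⟨_, rfl⟩))
      (fun k => mul_nonneg P.η_pos.le (by positivity)) fun k => (hC k).choose_spec.1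
  have hs0 : Tendsto (fun k => ‖R.acceptedStep f k‖) atTop (𝓝 0) := by
    have h1 : Tendsto (fun k => ‖R.acceptedStep f k‖ ^ 3) atTop (𝓝 0) := by
      have := hs3.const_mul P.η⁻¹
      simpa [← mul_assoc, inv_mul_cancel₀ P.η_pos.ne'] using this
    have h2 := h1.rpow_const (p := (1 / 3 : ℝ)) (Or.inr (by norm_num))
    rw [Real.zero_rpow (by norm_num)] at h2
    refine h2.congr fun k => ?_
    rw [← Real.rpow_natCast, ← Real.rpow_mul (norm_nonneg _)]
    norm_num
  have hgrad : Tendsto (fun k => ‖gradient f (R.x k)‖) atTop (𝓝 0) := by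
    refine tendsto_zero_of_recursion (b := fun k => (C + P.ξ₁) * ‖R.acceptedStep f k‖ ^ 2)
      (e := fun k => P.ξ₂ * ‖R.acceptedStep f k‖) (fun k => norm_nonneg _) (fun k => ?_) ?_ ?_
    · obtain ⟨μ, -, h1, h2, -⟩ := hC k
      linarith
    · simpa using (hs0.pow 2).const_mul (C + P.ξ₁)
    · simpa using hs0.const_mul P.ξ₂
  have hgs : gradient f xs = 0 := by
    have h1 := ((contDiff_gradient hC2).continuous.norm.tendsto xs).comp hφlim
    exact norm_eq_zero.1 (tendsto_nhds_unique h1 (hgrad.comp hφ.tendsto_atTop))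
  obtain ⟨m, M, hm, hM, hcmp⟩ := eventually_norm_gradient_comparable hC2 hgs hpos
  have hlim : Tendsto R.x atTop (𝓝 xs) := by
    refine tendsto_of_isolated_cluster hφ hφlim ?_ hgrad hm (hcmp.mono fun y hy => hy.1)
    refine hs0.congr fun k => ?_
    rw [hR.x_succ, add_sub_cancel_left]
  refine ⟨hlim, ?_⟩
  obtain ⟨c, hc, hcoer⟩ := eventually_inner_hess_ge hC2 hpos
  -- `M / c` bounds `‖s_k‖ / ‖x_k - xs‖`, with `c` the curvature bound; `1 / m` converts the next
  -- gradient norm into a distance.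
  refine ⟨C * (M / c) ^ 2 / m, 1 / m, M, by positivity, hM, ?_⟩
  filter_upwards [hlim.eventually hcmp, hlim.eventually hcoer,
    (hlim.comp (tendsto_add_atTop_nat 1)).eventually hcmp] with k h1 h2 h3
  refine ⟨?_, h1.2⟩
  obtain ⟨μ, -, hk1, -, hk2, hk3⟩ := hC k
  have h4 : ‖R.acceptedStep f k‖ ≤ M / c * ‖R.x k - xs‖ := by
    have h5 := (h2 (R.acceptedStep f k)).trans hk3
    have h6 : c * ‖R.acceptedStep f k‖ ≤ ‖gradient f (R.x k)‖ := by
      rcases (norm_nonneg (R.acceptedStep f k)).eq_or_lt with h0 | h0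
      · rw [← h0, mul_zero]; exact norm_nonneg _
      · exact le_of_mul_le_mul_left (by linarith) h0
    rw [div_mul_eq_mul_div, le_div_iff₀ hc]
    linarith [h1.2]
  have h7 : C * ‖R.acceptedStep f k‖ ^ 2 ≤ C * (M / c * ‖R.x k - xs‖) ^ 2 := by gcongr
  have h8 : m * ‖R.x (k + 1) - xs‖ ≤ C * (M / c * ‖R.x k - xs‖) ^ 2 + τ k (R.jLast k) := by
    have := h3.1
    simp only [Function.comp_apply] at this
    linarith
  calc _ ≤ (C * (M / c * ‖R.x k - xs‖) ^ 2 + τ k (R.jLast k)) / m := by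
        rw [le_div_iff₀ hm]; linarith
    _ = _ := by ring

end Trace

end ITrace

/-! ### The two rates of convergence -/

theorem theorem3p4 {n : ℕ} (P : ITrace.Params) (f : ITrace.Vec n → ℝ)
    (τ : ℕ → ℕ → ℝ) (hτ : ∀ k j, 0 ≤ τ k j)
    (R : ITrace.Trace n) (hR : R.IsRun P f τ)
    (hf : R.StandingAssumption f)
    (hg : ∀ k, gradient f (R.x k) ≠ 0)
    (xs : ITrace.Vec n)
    (hsub : ∃ φ : ℕ → ℕ, StrictMono φ ∧ Tendsto (fun i => R.x (φ i)) atTop (𝓝 xs))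
    (hpos : ∀ v : ITrace.Vec n, v ≠ 0 → 0 < inner ℝ v (ITrace.hess f xs v))
    (hloc : ∃ N ∈ 𝓝 xs, ∃ HLoc : NNReal, LipschitzOnWith HLoc (ITrace.hess f) N) :
    ((∃ ε : ℕ → ℝ, Tendsto ε atTop (𝓝 0) ∧
        ∀ k j, τ k j ≤ ε k * ‖gradient f (R.x k)‖) →
      ITrace.QSuperlinear R.x xs) ∧
    ((∃ c : ℝ, ∀ k j, τ k j ≤ c * ‖gradient f (R.x k)‖ ^ 2) →
      ITrace.QQuadratic R.x xs) := by
  obtain ⟨hlim, A, B, M, hB, hM, hrec⟩ := hR.local_recursion hτ hf hg hsub hpos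
  have hd : Tendsto (fun k => ‖R.x k - xs‖) atTop (𝓝 0) := tendsto_iff_norm_sub_tendsto_zero.1 hlim
  constructor
  · rintro ⟨ε, hε, hτε⟩
    refine ⟨hlim, Asymptotics.isLittleO_iff.2 fun r hr => ?_⟩
    have hcoef : Tendsto (fun k => A * ‖R.x k - xs‖ + B * M * |ε k|) atTop (𝓝 0) := by
      simpa using (hd.const_mul A).add (hε.abs.const_mul (B * M))
    filter_upwards [hrec, hcoef.eventually_lt_const hr] with k hk hkr
    rw [norm_norm, norm_norm]
    -- The absolute value makes the coefficient nonnegative, so that `‖g_k‖ ≤ M ‖x_k - xs‖` may be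
    -- inserted.
    have h1 : τ k (R.jLast k) ≤ |ε k| * (M * ‖R.x k - xs‖) :=
      (hτε k _).trans ((mul_le_mul_of_nonneg_right (le_abs_self _) (norm_nonneg _)).trans
        (mul_le_mul_of_nonneg_left hk.2 (abs_nonneg _)))
    calc _ ≤ A * ‖R.x k - xs‖ ^ 2 + B * (|ε k| * (M * ‖R.x k - xs‖)) :=
          hk.1.trans (by gcongr)
      _ = (A * ‖R.x k - xs‖ + B * M * |ε k|) * ‖R.x k - xs‖ := by ring
      _ ≤ r * ‖R.x k - xs‖ := mul_le_mul_of_nonneg_right hkr.le (norm_nonneg _)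
  · rintro ⟨c, hc⟩
    refine ⟨hlim, Asymptotics.IsBigO.of_bound (A + B * (|c| * M ^ 2)) ?_⟩
    filter_upwards [hrec] with k hk
    rw [norm_norm, Real.norm_of_nonneg (sq_nonneg _)]
    have h1 : τ k (R.jLast k) ≤ |c| * (M * ‖R.x k - xs‖) ^ 2 :=
      (hc k _).trans ((mul_le_mul_of_nonneg_right (le_abs_self _) (sq_nonneg _)).trans
        (mul_le_mul_of_nonneg_left (pow_le_pow_left₀ (norm_nonneg _) hk.2 2) (abs_nonneg _)))
    calc _ ≤ A * ‖R.x k - xs‖ ^ 2 + B * (|c| * (M * ‖R.x k - xs‖) ^ 2) :=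
          hk.1.trans (by gcongr)
      _ = _ := by ring
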